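/- Let $d,m,r,s\ge 0$ be integers and let $c_1,\dots,c_m$ be real $d\times d$ matrices such that every $c_i$ is invertible and $c_i-c_j$ is invertible for all $i\neq j$. Let $f_i$ ($1\le i\le m$), $a_\alpha$ ($\alpha\in\mathbb{N}^d$, $|\alpha|\le r$) and $b_\beta$ ($\beta\in\mathbb{N}^d$, $|\beta|\le s$) be complex-valued Schwartz distributions on $\mathbb{R}^d$, and suppose that $$\sum_{i=1}^m f_i(x+c_iy)=\sum_{|\alpha|\le r}x^\alpha\, a_\alpha(y)+\sum_{|\beta|\le s}b_\beta(x)\,y^\beta$$ holds as an equality in $\mathcal{D}(\mathbb{R}^d\times\mathbb{R}^d)'$. Here, for every test function $\varphi\in\mathcal{D}(\mathbb{R}^d\times\mathbb{R}^d)$, $$\langle f(x+cy),\varphi\rangle=\Big\langle f(u),\int_{\mathbb{R}^d}\varphi(u-cy,y)\,dy\Big\rangle,$$ $$\langle x^\alpha a(y),\varphi\rangle=\Big\langle a(y),\int_{\mathbb{R}^d}x^\alpha\varphi(x,y)\,dx\Big\rangle,\qquad \langle b(x)y^\beta,\varphi\rangle=\Big\langle b(x),\int_{\mathbb{R}^d}y^\beta\varphi(x,y)\,dy\Big\rangle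 .$$ Then every $f_i$ is an ordinary polynomial in the distributional sense: for each $i$ there is a polynomial $P_i\in\mathbb{C}[x_1,\dots,x_d]$ such that $\langle f_i,\varphi\rangle=\int_{\mathbb{R}^d}P_i(x)\varphi(x)\,dx$ for all $\varphi\in\mathcal{D}(\mathbb{R}^d)$. -/

import Mathlib

open MeasureTheory TopologicalSpace
open scoped Distributions ContDiff CompactConvergenceCLM

namespace GhuryeOlkin

/-- Euclidean space `ℝ^d`. -/
abbrev Eucl (d : ℕ) := EuclideanSpace ℝ (Fin d)

/-- Real-valued test functions on the whole space `V`. Complex-valued distributions are the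
continuous `ℝ`-linear maps from this space to `ℂ`, as everywhere in Mathlib. -/
abbrev Test (V : Type) [NormedAddCommGroup V] [NormedSpace ℝ V] := 𝓓((⊤ : Opens V), ℝ)

/-- Complex-valued Schwartz distributions on the whole space `V`. -/
abbrev Distr (V : Type) [NormedAddCommGroup V] [NormedSpace ℝ V] := 𝓓'((⊤ : Opens V), ℂ)

section FiberIntegral

variable {d : ℕ} {G : Type} [NormedAddCommGroup G] [NormedSpace ℝ G]

theorem fderiv_comp_inl_eq_zero {g : Eucl d × Eucl d → G} (hg : ContDiff ℝ 1 g)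
    {k : Set (Eucl d)} (h0 : ∀ x, ∀ y ∉ k, g (x, y) = 0) (x : Eucl d) (y : Eucl d) (hy : y ∉ k) :
    (fderiv ℝ g (x, y)).comp (ContinuousLinearMap.inl ℝ (Eucl d) (Eucl d)) = 0 := by
  have h1 : HasFDerivAt (fun x' ↦ g (x', y))
      ((fderiv ℝ g (x, y)).comp (ContinuousLinearMap.inl ℝ (Eucl d) (Eucl d))) x :=
    ((hg.differentiable one_ne_zero) (x, y)).hasFDerivAt.comp x (hasFDerivAt_prodMk_left x y)
  have h2 : (fun x' ↦ g (x', y)) = fun _ ↦ 0 := funext fun x' ↦ h0 x' y hy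
  rw [h2] at h1
  exact h1.unique (hasFDerivAt_const _ _)

theorem hasFDerivAt_fiberIntegral {g : Eucl d × Eucl d → G} (hg : ContDiff ℝ 1 g)
    {k : Set (Eucl d)} (hk : IsCompact k) (h0 : ∀ x, ∀ y ∉ k, g (x, y) = 0) (x₀ : Eucl d) :
    HasFDerivAt (fun x ↦ ∫ y, g (x, y))
      (∫ y, (fderiv ℝ g (x₀, y)).comp (ContinuousLinearMap.inl ℝ (Eucl d) (Eucl d))) x₀ := by
  have hd : Continuous fun z : Eucl d × Eucl d ↦
      (fderiv ℝ g z).comp (ContinuousLinearMap.inl ℝ (Eucl d) (Eucl d)) :=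
    (hg.continuous_fderiv one_ne_zero).clm_comp continuous_const
  have hder : ∀ x y, HasFDerivAt (fun x' ↦ g (x', y))
      ((fderiv ℝ g (x, y)).comp (ContinuousLinearMap.inl ℝ (Eucl d) (Eucl d))) x := fun x y ↦
    ((hg.differentiable one_ne_zero) (x, y)).hasFDerivAt.comp x (hasFDerivAt_prodMk_left x y)
  have hder0 := fderiv_comp_inl_eq_zero hg h0
  obtain ⟨C, hC⟩ := ((isCompact_closedBall x₀ 1).prod hk).exists_bound_of_continuousOn
    hd.continuousOn
  refine hasFDerivAt_integral_of_dominated_of_fderiv_le (bound := k.indicator fun _ ↦ C)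
    (F' := fun x y ↦ (fderiv ℝ g (x, y)).comp (ContinuousLinearMap.inl ℝ (Eucl d) (Eucl d)))
    (Metric.ball_mem_nhds x₀ one_pos) ?_ ?_ ?_ ?_ ?_ ?_
  · exact Filter.Eventually.of_forall fun x ↦
      (hg.continuous.comp (Continuous.prodMk_right x)).aestronglyMeasurable
  · exact (hg.continuous.comp (Continuous.prodMk_right x₀)).integrable_of_hasCompactSupport
      (HasCompactSupport.intro hk (h0 x₀))
  · exact (hd.comp (Continuous.prodMk_right x₀)).aestronglyMeasurable
  · refine Filter.Eventually.of_forall fun y x hx ↦ ?_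
    by_cases hy : y ∈ k
    · rw [Set.indicator_of_mem hy]
      exact hC (x, y) ⟨Metric.ball_subset_closedBall hx, hy⟩
    · rw [Set.indicator_of_notMem hy]
      simp only [hder0 x y hy, norm_zero, le_refl]
  · rw [integrable_indicator_iff hk.measurableSet]
    exact integrableOn_const hk.measure_lt_top.ne
  · exact Filter.Eventually.of_forall fun y x _ ↦ hder x y

/-- Bound for the derivatives of a fibre integral, together with its smoothness. -/
theorem fiberIntegral_bound (k : Set (Eucl d)) (hk : IsCompact k) (n : ℕ) :
    ∀ {G : Type} [NormedAddCommGroup G] [NormedSpace ℝ G] {g : Eucl d × Eucl d → G},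
      ContDiff ℝ ∞ g → (∀ x, ∀ y ∉ k, g (x, y) = 0) →
      ContDiff ℝ n (fun x ↦ ∫ y, g (x, y)) ∧
      ∀ C : ℝ, (∀ z, ‖iteratedFDeriv ℝ n g z‖ ≤ C) →
        ∀ x, ‖iteratedFDeriv ℝ n (fun x ↦ ∫ y, g (x, y)) x‖ ≤ C * volume.real k := by
  induction n with
  | zero =>
    intro G _ _ g hg h0
    refine ⟨?_, fun C hC x ↦ ?_⟩
    · exact contDiff_zero.2 (continuous_iff_continuousAt.2 fun x ↦
        (hasFDerivAt_fiberIntegral (hg.of_le (by exact_mod_cast le_top)) hk h0 x).continuousAt)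
    · rw [norm_iteratedFDeriv_zero, ← setIntegral_eq_integral_of_forall_compl_eq_zero
        (fun y hy ↦ h0 x y hy)]
      refine norm_setIntegral_le_of_norm_le_const hk.measure_lt_top fun y _ ↦ ?_
      simpa using hC (x, y)
  | succ n ih =>
    intro G _ _ g hg h0
    have hg1 : ContDiff ℝ 1 g := hg.of_le (by exact_mod_cast le_top)
    have hfd : ContDiff ℝ ∞ (fderiv ℝ g) := hg.fderiv_right (by simp)
    have hg' : ContDiff ℝ ∞ fun z : Eucl d × Eucl d ↦
        (fderiv ℝ g z).comp (ContinuousLinearMap.inl ℝ (Eucl d) (Eucl d)) :=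
      hfd.clm_comp contDiff_const
    have hI := hasFDerivAt_fiberIntegral hg1 hk h0
    have hfI : fderiv ℝ (fun x ↦ ∫ y, g (x, y)) = fun x ↦ ∫ y,
        (fderiv ℝ g (x, y)).comp (ContinuousLinearMap.inl ℝ (Eucl d) (Eucl d)) :=
      funext fun x ↦ (hI x).fderiv
    obtain ⟨ih1, ih2⟩ := ih hg' (fderiv_comp_inl_eq_zero hg1 h0)
    refine ⟨?_, fun C hC x ↦ ?_⟩
    · rw [Nat.cast_succ, contDiff_succ_iff_fderiv]
      exact ⟨fun x ↦ (hI x).differentiableAt, by simp, hfI ▸ ih1⟩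
    · rw [← norm_iteratedFDeriv_fderiv, hfI]
      refine ih2 C (fun z ↦ ?_) x
      have hL := ContinuousLinearMap.norm_iteratedFDeriv_comp_left
        ((ContinuousLinearMap.compL ℝ (Eucl d) (Eucl d × Eucl d) G).flip
          (ContinuousLinearMap.inl ℝ (Eucl d) (Eucl d)))
        (f := fderiv ℝ g) (x := z) (N := ∞) hfd.contDiffAt (n := n) (by exact_mod_cast le_top)
      refine hL.trans ?_
      rw [norm_iteratedFDeriv_fderiv]
      have h1 : ‖(ContinuousLinearMap.compL ℝ (Eucl d) (Eucl d × Eucl d) G).flip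
          (ContinuousLinearMap.inl ℝ (Eucl d) (Eucl d))‖ ≤ 1 := by
        refine ContinuousLinearMap.opNorm_le_bound _ zero_le_one fun A ↦ ?_
        refine (ContinuousLinearMap.opNorm_comp_le A _).trans ?_
        rw [one_mul]
        exact mul_le_of_le_one_right (norm_nonneg _) (ContinuousLinearMap.norm_inl_le_one ℝ _ _)
      calc _ ≤ 1 * C := mul_le_mul h1 (hC z) (norm_nonneg _) zero_le_one
        _ = C := one_mul C

end FiberIntegral

/-- Integration over the second variable on test functions supported in a fixed compact set. -/
noncomputable def fiberIntegralSupportedIn (d : ℕ) (K : Compacts (Eucl d × Eucl d)) :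
    𝓓_{K}(Eucl d × Eucl d, ℝ) →ₗ[ℝ] 𝓓_{K.map Prod.fst continuous_fst}(Eucl d, ℝ) where
  toFun φ := ⟨fun x ↦ ∫ y, φ (x, y), ?smooth, ?supp⟩
  map_add' φ ψ := ?add
  map_smul' c φ := ?smul
where finally
  case smooth =>
    refine contDiff_infty.2 fun n ↦ (fiberIntegral_bound (Prod.snd '' (K : Set (Eucl d × Eucl d)))
      (K.isCompact.image continuous_snd) n φ.contDiff ?_).1
    intro x y hy
    exact φ.zero_on_compl fun h ↦ hy ⟨_, h, rfl⟩
  case supp =>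
    intro x hx
    have : ∀ y, φ (x, y) = 0 := fun y ↦ φ.zero_on_compl fun h ↦ hx ⟨_, h, rfl⟩
    simp [this]
  case add =>
    ext x
    have hi : ∀ χ : 𝓓_{K}(Eucl d × Eucl d, ℝ), Integrable fun y ↦ χ (x, y) := by
      intro χ
      refine (χ.continuous.comp (Continuous.prodMk_right x)).integrable_of_hasCompactSupport
        (HasCompactSupport.intro (K.isCompact.image continuous_snd) ?_)
      intro y hy
      exact χ.zero_on_compl fun h ↦ hy ⟨_, h, rfl⟩
    exact integral_add (hi φ) (hi ψ)
  case smul =>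
    ext x
    exact integral_const_mul c fun y ↦ φ (x, y)

theorem continuous_fiberIntegralSupportedIn (d : ℕ) (K : Compacts (Eucl d × Eucl d)) :
    Continuous (fiberIntegralSupportedIn d K) := by
  refine WithSeminorms.continuous_of_isBounded (ContDiffMapSupportedIn.withSeminorms ℝ _ _ _ _)
    (ContDiffMapSupportedIn.withSeminorms ℝ _ _ _ _) _ (.of_real fun i ↦
      ⟨{i}, volume.real (Prod.snd '' (K : Set (Eucl d × Eucl d))), fun φ ↦ ?_⟩)
  refine (ContDiffMapSupportedIn.seminorm_top_le_iff ℝ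
    (mul_nonneg measureReal_nonneg (apply_nonneg _ _)) i _).2 fun x _ ↦ ?_
  rw [mul_comm, Finset.sup_singleton]
  refine (fiberIntegral_bound (Prod.snd '' (K : Set (Eucl d × Eucl d)))
    (K.isCompact.image continuous_snd) i φ.contDiff ?_).2 _ (fun z ↦ ?_) x
  · intro x y hy
    exact φ.zero_on_compl fun h ↦ hy ⟨_, h, rfl⟩
  · exact ContDiffMapSupportedIn.norm_iteratedFDeriv_apply_le_seminorm_top ℝ

/-- Integration over the second variable, `φ ↦ (x ↦ ∫ φ(x, y) dy)`, as a continuous linear map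
`𝓓(ℝ^d × ℝ^d) → 𝓓(ℝ^d)`. -/
noncomputable def fiberIntegral (d : ℕ) : Test (Eucl d × Eucl d) →L[ℝ] Test (Eucl d) :=
  TestFunction.limitCLM ℝ
    (fun φ ↦ ⟨fun x ↦ ∫ y, φ (x, y), ?smooth, ?compact, fun _ _ ↦ trivial⟩)
    (fun K _ ↦ TestFunction.ofSupportedInCLM ℝ (fun _ _ ↦ trivial) ∘L
      ⟨fiberIntegralSupportedIn d K, continuous_fiberIntegralSupportedIn d K⟩)
    (fun _ _ _ ↦ rfl)
where finally
  case smooth =>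
    refine contDiff_infty.2 fun n ↦ (fiberIntegral_bound (Prod.snd '' tsupport φ)
      (φ.hasCompactSupport.isCompact.image continuous_snd) n φ.contDiff ?_).1
    intro x y hy
    exact image_eq_zero_of_notMem_tsupport fun h ↦ hy ⟨_, h, rfl⟩
  case compact =>
    refine HasCompactSupport.intro (φ.hasCompactSupport.isCompact.image continuous_fst) ?_
    intro x hx
    have : ∀ y, φ (x, y) = 0 := fun y ↦
      image_eq_zero_of_notMem_tsupport fun h ↦ hx ⟨_, h, rfl⟩
    simp [this]

theorem fiberIntegral_apply {d : ℕ} (φ : Test (Eucl d × Eucl d)) (x : Eucl d) :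
    fiberIntegral d φ x = ∫ y, φ (x, y) := rfl

/-- Composition with a linear isomorphism, `φ ↦ φ ∘ L`, on test functions. -/
noncomputable def compEquiv {V : Type} [NormedAddCommGroup V] [NormedSpace ℝ V]
    (L : V ≃L[ℝ] V) : Test V →L[ℝ] Test V :=
  TestFunction.limitCLM ℝ
    (fun φ ↦ ⟨fun x ↦ φ (L x), φ.contDiff.comp L.contDiff,
      φ.hasCompactSupport.comp_homeomorph L.toHomeomorph, fun _ _ ↦ trivial⟩)
    (fun K _ ↦ TestFunction.ofSupportedInCLM ℝ
        (K := ⟨L.symm '' (K : Set V), K.isCompact.image L.symm.continuous⟩)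
        (fun _ _ ↦ trivial) ∘L
      ContDiffMapSupportedIn.mkCLM ℝ (fun φ x ↦ φ (L x)) (fun _ _ _ ↦ rfl) (fun _ _ _ ↦ rfl)
        (fun φ ↦ φ.contDiff.comp L.contDiff) ?supp ?bound)
    (fun _ _ _ ↦ rfl)
where finally
  case supp =>
    intro φ x hx
    exact φ.zero_on_compl fun h ↦ hx ⟨_, h, L.symm_apply_apply x⟩
  case bound =>
    intro i _
    refine ⟨{i}, ‖(L : V →L[ℝ] V)‖ ^ i, by positivity, fun φ x _ ↦ ?_⟩
    rw [Finset.sup_singleton]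
    have h := (L : V →L[ℝ] V).iteratedFDeriv_comp_right (f := φ) (n := ∞) φ.contDiff x (i := i)
      (by exact_mod_cast le_top)
    have h' : iteratedFDeriv ℝ i (fun x ↦ φ (L x)) x = _ := h
    rw [h']
    refine (ContinuousMultilinearMap.norm_compContinuousLinearMap_le _ _).trans ?_
    rw [Finset.prod_const, Finset.card_univ, Fintype.card_fin, mul_comm]
    gcongr
    exact ContDiffMapSupportedIn.norm_iteratedFDeriv_apply_le_seminorm_top ℝ

theorem compEquiv_apply {V : Type} [NormedAddCommGroup V] [NormedSpace ℝ V]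
    (L : V ≃L[ℝ] V) (φ : Test V) (x : V) : compEquiv L φ x = φ (L x) := rfl

/-- Multiplication by a smooth function, `φ ↦ φ · w`, on test functions. -/
noncomputable def mulSmooth {V : Type} [NormedAddCommGroup V] [NormedSpace ℝ V]
    (w : V → ℝ) (hw : ContDiff ℝ ∞ w) : Test V →L[ℝ] Test V :=
  TestFunction.limitCLM ℝ
    (fun φ ↦ ⟨fun x ↦ φ x * w x, φ.contDiff.mul hw, φ.hasCompactSupport.mul_right,
      fun _ _ ↦ trivial⟩)
    (fun _ hK ↦ TestFunction.ofSupportedInCLM ℝ hK ∘L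
      ContDiffMapSupportedIn.bilinLeftCLM (ContinuousLinearMap.mul ℝ ℝ) hw)
    (fun _ _ _ ↦ rfl)

theorem mulSmooth_apply {V : Type} [NormedAddCommGroup V] [NormedSpace ℝ V]
    (w : V → ℝ) (hw : ContDiff ℝ ∞ w) (φ : Test V) (x : V) :
    mulSmooth w hw φ x = φ x * w x := rfl

/-- The monomial `x^α = ∏ⱼ xⱼ^{αⱼ}` on `ℝ^d`. -/
def monomial {d : ℕ} (α : Fin d → ℕ) (x : Eucl d) : ℝ := ∏ j, x j ^ α j

theorem contDiff_monomial {d : ℕ} (α : Fin d → ℕ) : ContDiff ℝ ∞ (monomial α) := by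
  unfold monomial
  fun_prop

/-- The linear isomorphism `(u, y) ↦ (u - c y, y)` of `ℝ^d × ℝ^d`, the inverse of
`(x, y) ↦ (x + c y, y)`. -/
noncomputable def shear {d : ℕ} (c : Matrix (Fin d) (Fin d) ℝ) :
    (Eucl d × Eucl d) ≃L[ℝ] (Eucl d × Eucl d) :=
  ContinuousLinearEquiv.equivOfInverse
    ((ContinuousLinearMap.fst ℝ _ _ -
      Matrix.toEuclideanCLM (𝕜 := ℝ) c ∘L ContinuousLinearMap.snd ℝ _ _).prod
        (ContinuousLinearMap.snd ℝ _ _))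
    ((ContinuousLinearMap.fst ℝ _ _ +
      Matrix.toEuclideanCLM (𝕜 := ℝ) c ∘L ContinuousLinearMap.snd ℝ _ _).prod
        (ContinuousLinearMap.snd ℝ _ _))
    (fun z ↦ by simp) (fun z ↦ by simp)

theorem shear_apply {d : ℕ} (c : Matrix (Fin d) (Fin d) ℝ) (u y : Eucl d) :
    shear c (u, y) = (u - Matrix.toEuclideanCLM (𝕜 := ℝ) c y, y) := rfl

/-- The distribution `f(x + c y)` in the two variables `(x, y)`:
`⟨f(x + c y), φ(x, y)⟩ = ⟨f(u), ∫ φ(u - c y, y) dy⟩`, which for a locally integrable function `f`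
is the change of variables `u = x + c y`. -/
noncomputable def pullback {d : ℕ} (c : Matrix (Fin d) (Fin d) ℝ) (f : Distr (Eucl d)) :
    Distr (Eucl d × Eucl d) :=
  (fiberIntegral d ∘L compEquiv (shear c)).precompCompactConvergenceCLM ℂ f

theorem pullback_apply {d : ℕ} (c : Matrix (Fin d) (Fin d) ℝ) (f : Distr (Eucl d))
    (φ : Test (Eucl d × Eucl d)) :
    pullback c f φ = f (fiberIntegral d (compEquiv (shear c) φ)) := rfl

/-- The distribution `b(x) · y^β` in the two variables `(x, y)`:
`⟨b(x) y^β, φ(x, y)⟩ = ⟨b(x), ∫ φ(x, y) y^β dy⟩`. -/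
noncomputable def tensorMonomialRight {d : ℕ} (b : Distr (Eucl d)) (β : Fin d → ℕ) :
    Distr (Eucl d × Eucl d) :=
  (fiberIntegral d ∘L mulSmooth (fun z : Eucl d × Eucl d ↦ monomial β z.2)
    ((contDiff_monomial β).comp contDiff_snd)).precompCompactConvergenceCLM ℂ b

/-- The distribution `x^α · a(y)` in the two variables `(x, y)`:
`⟨x^α a(y), φ(x, y)⟩ = ⟨a(y), ∫ φ(x, y) x^α dx⟩`. -/
noncomputable def tensorMonomialLeft {d : ℕ} (α : Fin d → ℕ) (a : Distr (Eucl d)) :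
    Distr (Eucl d × Eucl d) :=
  (fiberIntegral d ∘L compEquiv (ContinuousLinearEquiv.prodComm ℝ (Eucl d) (Eucl d)) ∘L
    mulSmooth (fun z : Eucl d × Eucl d ↦ monomial α z.1)
      ((contDiff_monomial α).comp contDiff_fst)).precompCompactConvergenceCLM ℂ a

theorem tensorMonomialRight_apply {d : ℕ} (b : Distr (Eucl d)) (β : Fin d → ℕ)
    (φ : Test (Eucl d × Eucl d)) :
    tensorMonomialRight b β φ = b (fiberIntegral d (mulSmooth (fun z : Eucl d × Eucl d ↦ monomial β z.2)
      ((contDiff_monomial β).comp contDiff_snd) φ)) := rfl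

theorem tensorMonomialLeft_apply {d : ℕ} (α : Fin d → ℕ) (a : Distr (Eucl d))
    (φ : Test (Eucl d × Eucl d)) :
    tensorMonomialLeft α a φ =
      a (fiberIntegral d (compEquiv (ContinuousLinearEquiv.prodComm ℝ (Eucl d) (Eucl d))
        (mulSmooth (fun z : Eucl d × Eucl d ↦ monomial α z.1) ((contDiff_monomial α).comp contDiff_fst) φ))) := rfl

/-- The multi-indices `α ∈ ℕ^d` with `|α| = ∑ⱼ αⱼ ≤ r`. -/
def multiIndices (d r : ℕ) : Finset (Fin d → ℕ) :=
  (Fintype.piFinset fun _ ↦ Finset.range (r + 1)).filter fun α ↦ ∑ j, α j ≤ r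

theorem mem_multiIndices {d r : ℕ} {α : Fin d → ℕ} :
    α ∈ multiIndices d r ↔ ∑ j, α j ≤ r := by
  simp only [multiIndices, Finset.mem_filter, Fintype.mem_piFinset, Finset.mem_range,
    Nat.lt_succ_iff, and_iff_right_iff_imp]
  exact fun h j ↦ (Finset.single_le_sum (fun _ _ ↦ Nat.zero_le _) (Finset.mem_univ j)).trans h

/-- The distribution `T` on `ℝ^d` is (integration against) an ordinary polynomial with complex
coefficients. -/
def IsPolynomial {d : ℕ} (T : Distr (Eucl d)) : Prop :=
  ∃ P : MvPolynomial (Fin d) ℂ, ∀ φ : Test (Eucl d),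
    T φ = ∫ x : Eucl d, (φ x : ℂ) * MvPolynomial.eval (fun j ↦ (x j : ℂ)) P

end GhuryeOlkin

/-! Differentiating `f(x + c y)` along `(h, k)` gives the derivative of `f` along `h + c k`,
composed with the same map (`shearIntegral_comp_lineD`). Hence differentiating the equation keeps
its shape, and three choices of direction simplify it. Directions `(0, k)` lower the degree in `y`
of the terms `b(x) y^β`; directions `(h, 0)` lower the degree in `x` of the terms `x^α a(y)`;
directions `(-c_j k, k)` remove the term `f_j`. Meanwhile `f_i` is differentiated along `c_i k`, `h`
and `(c_i - c_j) k` respectively, and by invertibility each of these is an arbitrary vector. After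
`s + 1`, `r + 1` and `m - 1` such steps only a derivative of `f_i`, evaluated at `x + c_i y`, is
left, and it must vanish. So all derivatives of `f_i` of order `m + r + s + 1` are zero
(`killsIn_of_sum_eq_add`).

It remains that a functional with vanishing derivatives of some order is a polynomial
(`annihilatedArePolynomial`). This goes by induction on the dimension and, inside, on the order: a
test function on `ℝ^d × ℝ` is a tensor product carrying its line integrals plus a derivative in the
last variable (`exists_lineD_eq`). Neither half uses continuity, so everything is done for linear
functionals, with derivatives transposed without the usual sign. -/

namespace GhuryeOlkin

/-! ### Operations on test functions: derivatives, substitutions, tensor products -/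

section TestFunctions

variable {V W : Type} [NormedAddCommGroup V] [NormedSpace ℝ V] [NormedAddCommGroup W]
  [NormedSpace ℝ W]

theorem Test.differentiable (φ : Test V) : Differentiable ℝ φ :=
  φ.contDiff.differentiable (by simp)

/-- The directional derivative on test functions. -/
noncomputable def lineD (v : V) : Test V →ₗ[ℝ] Test V where
  toFun φ := ⟨fun x ↦ fderiv ℝ φ x v,
    (φ.contDiff.fderiv_right (m := ∞) (by simp)).clm_apply contDiff_const,
    φ.hasCompactSupport.fderiv_apply ℝ v, fun _ _ ↦ trivial⟩
  map_add' φ ψ := by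
    ext x
    change fderiv ℝ (⇑φ + ⇑ψ) x v = fderiv ℝ φ x v + fderiv ℝ ψ x v
    rw [fderiv_add (φ.differentiable x) (ψ.differentiable x)]
    rfl
  map_smul' r φ := by
    ext x
    change fderiv ℝ (r • ⇑φ) x v = r • fderiv ℝ φ x v
    rw [fderiv_const_smul (φ.differentiable x)]
    rfl

theorem lineD_apply (v : V) (φ : Test V) (x : V) : lineD v φ x = fderiv ℝ φ x v := rfl

theorem lineD_comm (v w : V) (φ : Test V) : lineD v (lineD w φ) = lineD w (lineD v φ) := by
  have hd : Differentiable ℝ (fderiv ℝ φ) :=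
    (φ.contDiff.fderiv_right (m := ∞) (by simp)).differentiable (by simp)
  have key : ∀ (v w x : V), lineD v (lineD w φ) x = fderiv ℝ (fderiv ℝ φ) x v w := by
    intro v w x
    change fderiv ℝ (fun y ↦ fderiv ℝ φ y w) x v = _
    rw [fderiv_clm_apply (hd x) (differentiableAt_const w)]
    simp
  ext x
  rw [key, key]
  exact (φ.contDiff.contDiffAt.isSymmSndFDerivAt
    (by simp only [minSmoothness_of_isRCLikeNormedField]; exact ENat.LEInfty.out)).eq v w

/-- Composition with a linear isomorphism between two spaces, on test functions. -/
noncomputable def compIso (L : V ≃L[ℝ] W) : Test W →ₗ[ℝ] Test V where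
  toFun φ := ⟨fun x ↦ φ (L x), φ.contDiff.comp L.contDiff,
    φ.hasCompactSupport.comp_homeomorph L.toHomeomorph, fun _ _ ↦ trivial⟩
  map_add' _ _ := rfl
  map_smul' _ _ := rfl

theorem compIso_apply (L : V ≃L[ℝ] W) (φ : Test W) (x : V) : compIso L φ x = φ (L x) := rfl

theorem compIso_lineD (L : V ≃L[ℝ] W) (v : V) (φ : Test W) :
    compIso L (lineD (L v) φ) = lineD v (compIso L φ) := by
  ext x
  change fderiv ℝ φ (L x) (L v) = fderiv ℝ (φ ∘ L) x v
  rw [fderiv_comp x (φ.differentiable _) L.differentiableAt, L.fderiv]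
  rfl

/-- The tensor product of two test functions. -/
noncomputable def tens (ρ : Test W) : Test V →ₗ[ℝ] Test (V × W) where
  toFun φ := ⟨fun z ↦ φ z.1 * ρ z.2,
    (φ.contDiff.comp contDiff_fst).mul (ρ.contDiff.comp contDiff_snd),
    HasCompactSupport.intro (φ.hasCompactSupport.isCompact.prod ρ.hasCompactSupport.isCompact)
      fun z hz ↦ by
        by_cases h : z.1 ∈ tsupport φ
        · rw [image_eq_zero_of_notMem_tsupport fun h' ↦ hz ⟨h, h'⟩, mul_zero]
        · rw [image_eq_zero_of_notMem_tsupport h, zero_mul],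
    fun _ _ ↦ trivial⟩
  map_add' φ ψ := by ext z; exact add_mul _ _ _
  map_smul' r φ := by ext z; exact mul_assoc _ _ _

theorem tens_apply (ρ : Test W) (φ : Test V) (z : V × W) : tens ρ φ z = φ z.1 * ρ z.2 := rfl

theorem lineD_tens (ρ : Test W) (φ : Test V) (v : V) :
    lineD ((v, 0) : V × W) (tens ρ φ) = tens ρ (lineD v φ) := by
  ext z
  have h1 : HasFDerivAt (fun z : V × W ↦ φ z.1)
      ((fderiv ℝ φ z.1).comp (ContinuousLinearMap.fst ℝ V W)) z :=
    (φ.differentiable z.1).hasFDerivAt.comp z hasFDerivAt_fst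
  have h2 : HasFDerivAt (fun z : V × W ↦ ρ z.2)
      ((fderiv ℝ ρ z.2).comp (ContinuousLinearMap.snd ℝ V W)) z :=
    (ρ.differentiable z.2).hasFDerivAt.comp z hasFDerivAt_snd
  have h := (h1.mul h2).fderiv
  change fderiv ℝ (fun z : V × W ↦ φ z.1 * ρ z.2) z (v, 0) = fderiv ℝ φ z.1 v * ρ z.2
  rw [show (fun z : V × W ↦ φ z.1 * ρ z.2) = (fun z ↦ φ z.1) * fun z ↦ ρ z.2 from rfl, h]
  simp [mul_comm]

/-- A test function of integral one. -/
theorem exists_test_integral_eq_one (V : Type) [NormedAddCommGroup V] [NormedSpace ℝ V]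
    [FiniteDimensional ℝ V] [MeasurableSpace V] [BorelSpace V] (μ : Measure V)
    [μ.IsAddHaarMeasure] : ∃ ρ : Test V, ∫ x, ρ x ∂μ = 1 := by
  let b : ContDiffBump (0 : V) := ⟨1, 2, one_pos, one_lt_two⟩
  exact ⟨⟨b.normed μ, b.contDiff_normed, b.hasCompactSupport_normed, fun _ _ ↦ trivial⟩,
    b.integral_normed⟩

/-- The Leibniz rule, arranged so that a derivative can be moved from the test function onto the
weight. -/
theorem lineD_mulSmooth (w : V → ℝ) (hw : ContDiff ℝ ∞ w) (v : V)
    (hw' : ContDiff ℝ ∞ fun x ↦ fderiv ℝ w x v) (φ : Test V) :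
    mulSmooth w hw (lineD v φ) =
      lineD v (mulSmooth w hw φ) - mulSmooth (fun x ↦ fderiv ℝ w x v) hw' φ := by
  ext x
  change fderiv ℝ φ x v * w x = fderiv ℝ (⇑φ * w) x v - φ x * fderiv ℝ w x v
  rw [fderiv_mul (φ.differentiable x) (hw.differentiable (by simp) x)]
  simp only [_root_.add_apply, _root_.smul_apply, smul_eq_mul]
  ring

end TestFunctions

/-! ### Functionals killed by all derivatives of a given order -/

section Annihilation

variable {V W : Type} [NormedAddCommGroup V] [NormedSpace ℝ V] [NormedAddCommGroup W]
  [NormedSpace ℝ W]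

/-- The functional `F` vanishes on all `n`-fold derivatives in directions from `S`. -/
def KillsIn (S : Set V) : ℕ → (Test V →ₗ[ℝ] ℂ) → Prop
  | 0, F => F = 0
  | n + 1, F => ∀ v ∈ S, KillsIn S n (F ∘ₗ lineD v)

theorem KillsIn.zero (S : Set V) (n : ℕ) : KillsIn S n 0 := by
  induction n with
  | zero => exact rfl
  | succ n ih => exact fun v _ ↦ by rwa [LinearMap.zero_comp]

theorem KillsIn.add {S : Set V} {n : ℕ} {F G : Test V →ₗ[ℝ] ℂ} (hF : KillsIn S n F)
    (hG : KillsIn S n G) : KillsIn S n (F + G) := by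
  induction n generalizing F G with
  | zero =>
    change F + G = 0
    rw [show F = 0 from hF, show G = 0 from hG, add_zero]
  | succ n ih => exact fun v hv ↦ by rw [LinearMap.add_comp]; exact ih (hF v hv) (hG v hv)

theorem KillsIn.neg {S : Set V} {n : ℕ} {F : Test V →ₗ[ℝ] ℂ} (hF : KillsIn S n F) :
    KillsIn S n (-F) := by
  induction n generalizing F with
  | zero =>
    change -F = 0
    rw [show F = 0 from hF, neg_zero]
  | succ n ih => exact fun v hv ↦ by rw [LinearMap.neg_comp]; exact ih (hF v hv)

theorem KillsIn.sum {S : Set V} {n : ℕ} {ι : Type*} (s : Finset ι) {F : ι → Test V →ₗ[ℝ] ℂ}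
    (hF : ∀ i ∈ s, KillsIn S n (F i)) : KillsIn S n (∑ i ∈ s, F i) :=
  Finset.sum_induction _ (KillsIn S n) (fun _ _ ↦ KillsIn.add) (KillsIn.zero S n) hF

/-- Derivatives commute, so an extra one in any direction, not only in `S`, does no harm. This
protects the `x^α` terms while the `y^β` terms are being removed. -/
theorem KillsIn.comp_lineD {S : Set V} {n : ℕ} {F : Test V →ₗ[ℝ] ℂ} (hF : KillsIn S n F)
    (w : V) : KillsIn S n (F ∘ₗ lineD w) := by
  induction n generalizing F with
  | zero =>
    change F ∘ₗ lineD w = 0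
    rw [show F = 0 from hF, LinearMap.zero_comp]
  | succ n ih =>
    intro v hv
    have : (F ∘ₗ lineD w) ∘ₗ lineD v = (F ∘ₗ lineD v) ∘ₗ lineD w :=
      LinearMap.ext fun φ ↦ congrArg F (lineD_comm w v φ)
    rw [this]
    exact ih (hF v hv)

/-- Annihilation passes along maps that intertwine the derivatives. -/
theorem KillsIn.comp_of_intertwine {S : Set V} {S' : Set W} {n : ℕ} {F : Test V →ₗ[ℝ] ℂ}
    (hF : KillsIn S n F) (A : Test W →ₗ[ℝ] Test V)
    (hA : ∀ w ∈ S', ∃ v ∈ S, A ∘ₗ lineD w = lineD v ∘ₗ A) : KillsIn S' n (F ∘ₗ A) := by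
  induction n generalizing F with
  | zero =>
    change F ∘ₗ A = 0
    rw [show F = 0 from hF, LinearMap.zero_comp]
  | succ n ih =>
    intro w hw
    obtain ⟨v, hv, h⟩ := hA w hw
    rw [LinearMap.comp_assoc, h, ← LinearMap.comp_assoc]
    exact ih (hF v hv)

end Annihilation

/-! ### Degree of weights, measured by vanishing derivatives -/

section PolynomialDegree

variable {V : Type} [NormedAddCommGroup V] [NormedSpace ℝ V]

/-- All `n`-fold directional derivatives of the smooth function `w` vanish. -/
def DegLT : ℕ → (V → ℝ) → Prop
  | 0, w => w = 0
  | n + 1, w => ∀ v, DegLT n fun x ↦ fderiv ℝ w x v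

theorem contDiff_fderiv_apply {w : V → ℝ} (hw : ContDiff ℝ ∞ w) (v : V) :
    ContDiff ℝ ∞ fun x ↦ fderiv ℝ w x v :=
  (hw.fderiv_right (m := ∞) (by simp)).clm_apply contDiff_const

theorem DegLT.zero (n : ℕ) : DegLT n (0 : V → ℝ) := by
  induction n with
  | zero => exact rfl
  | succ n ih => intro v; simpa [Pi.zero_def] using ih

theorem DegLT.succ {n : ℕ} {w : V → ℝ} (h : DegLT n w) : DegLT (n + 1) w := by
  induction n generalizing w with
  | zero => rw [show w = 0 from h]; exact DegLT.zero _
  | succ n ih => exact fun v ↦ ih (h v)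

theorem DegLT.mono {n k : ℕ} {w : V → ℝ} (h : DegLT n w) (hnk : n ≤ k) : DegLT k w :=
  Nat.le_induction h (fun _ _ ↦ DegLT.succ) k hnk

theorem DegLT.add {n : ℕ} {w u : V → ℝ} (hw : ContDiff ℝ ∞ w) (hu : ContDiff ℝ ∞ u)
    (h : DegLT n w) (h' : DegLT n u) : DegLT n (w + u) := by
  induction n generalizing w u with
  | zero =>
    change w + u = 0
    rw [show w = 0 from h, show u = 0 from h', add_zero]
  | succ n ih =>
    intro v
    have : (fun x ↦ fderiv ℝ (w + u) x v) =
        (fun x ↦ fderiv ℝ w x v) + fun x ↦ fderiv ℝ u x v := by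
      ext x
      rw [fderiv_add (hw.differentiable (by simp) x) (hu.differentiable (by simp) x)]
      rfl
    rw [this]
    exact ih (contDiff_fderiv_apply hw v) (contDiff_fderiv_apply hu v) (h v) (h' v)

theorem DegLT.const_smul {n : ℕ} {w : V → ℝ} (hw : ContDiff ℝ ∞ w) (r : ℝ) (h : DegLT n w) :
    DegLT n (r • w) := by
  induction n generalizing w with
  | zero =>
    change r • w = 0
    rw [show w = 0 from h, smul_zero]
  | succ n ih =>
    intro v
    have : (fun x ↦ fderiv ℝ (r • w) x v) = r • fun x ↦ fderiv ℝ w x v := by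
      ext x
      rw [fderiv_const_smul (hw.differentiable (by simp) x)]
      rfl
    rw [this]
    exact ih (contDiff_fderiv_apply hw v) (h v)

/-- Since `∂_v (ℓ w) = ℓ ∂_v w + ℓ(v) w`, the first summand falls to the induction and the second to
the hypothesis on `w`. -/
theorem DegLT.linear_mul {n : ℕ} {w : V → ℝ} (hw : ContDiff ℝ ∞ w) (ℓ : V →L[ℝ] ℝ)
    (h : DegLT n w) : DegLT (n + 1) (⇑ℓ * w) := by
  induction n generalizing w with
  | zero => rw [show w = 0 from h, mul_zero]; exact DegLT.zero _
  | succ n ih =>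
    intro v
    have : (fun x ↦ fderiv ℝ (⇑ℓ * w) x v) =
        (⇑ℓ * fun x ↦ fderiv ℝ w x v) + ℓ v • w := by
      ext x
      rw [fderiv_mul ℓ.differentiableAt (hw.differentiable (by simp) x), ℓ.fderiv]
      simp [mul_comm]
    rw [this]
    exact DegLT.add (ℓ.contDiff.mul (contDiff_fderiv_apply hw v)) (hw.const_smul (ℓ v))
      (ih (contDiff_fderiv_apply hw v) (h v)) (h.const_smul hw _)

theorem degLT_monomial {d : ℕ} (α : Fin d → ℕ) : DegLT (∑ j, α j + 1) (monomial α) := by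
  have hpow : ∀ (ℓ : Eucl d →L[ℝ] ℝ) (k : ℕ) {n : ℕ} {w : Eucl d → ℝ}, ContDiff ℝ ∞ w →
      DegLT n w → DegLT (n + k) ((⇑ℓ) ^ k * w) := by
    intro ℓ k n w hw h
    induction k with
    | zero => simpa using h
    | succ k ih =>
      rw [pow_succ', mul_assoc, ← add_assoc]
      exact ih.linear_mul ((ℓ.contDiff.pow k).mul hw) ℓ
  -- The leading `1` is for the empty product: the constant `1` needs one derivative to vanish.
  have key : ∀ s : Finset (Fin d),
      DegLT (1 + ∑ j ∈ s, α j) (∏ j ∈ s, (⇑(EuclideanSpace.proj j : Eucl d →L[ℝ] ℝ)) ^ α j) := by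
    intro s
    induction s using Finset.induction_on with
    | empty =>
      intro v
      simp only [Finset.prod_empty]
      change (fun x ↦ fderiv ℝ (fun _ : Eucl d ↦ (1 : ℝ)) x v) = 0
      ext x
      simp
    | insert j s hj ih =>
      rw [Finset.prod_insert hj, Finset.sum_insert hj, add_comm (α j), ← add_assoc]
      refine hpow _ _ ?_ ih
      rw [Finset.prod_fn]
      exact contDiff_prod fun i _ ↦ (EuclideanSpace.proj i : Eucl d →L[ℝ] ℝ).contDiff.pow _
  have h := key Finset.univ
  rw [add_comm] at h
  convert h using 1
  ext x
  simp [monomial]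

end PolynomialDegree

/-! ### Elimination of terms by differentiating the functional equation -/

section Elimination

variable {d : ℕ}

theorem Test.integral_fderiv_eq_zero (φ : Test (Eucl d)) (v : Eucl d) :
    ∫ x, fderiv ℝ φ x v = 0 := by
  have h := integral_mul_fderiv_eq_neg_fderiv_mul_of_integrable (𝕜 := ℝ) (μ := volume)
    (f := fun _ : Eucl d ↦ (1 : ℝ)) (g := φ) (v := v) (by simp)
    (by
      simp only [one_mul]
      exact (lineD v φ).continuous.integrable_of_hasCompactSupport (lineD v φ).hasCompactSupport)
    (by
      simp only [one_mul]
      exact φ.continuous.integrable_of_hasCompactSupport φ.hasCompactSupport)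
    (fun x _ ↦ differentiableAt_const _) (fun x _ ↦ φ.differentiable x)
  simpa using h

/-- The restriction of a test function to a fibre. -/
noncomputable def fiber {V W : Type} [NormedAddCommGroup V] [NormedSpace ℝ V]
    [NormedAddCommGroup W] [NormedSpace ℝ W] (Φ : Test (V × W)) (x : V) : Test W :=
  ⟨fun y ↦ Φ (x, y), Φ.contDiff.comp (contDiff_prodMk_right x),
    HasCompactSupport.intro (Φ.hasCompactSupport.isCompact.image continuous_snd) fun _ hy ↦
      image_eq_zero_of_notMem_tsupport fun h ↦ hy ⟨_, h, rfl⟩,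
    fun _ _ ↦ trivial⟩

/-- The `x`-part of the derivative passes under the integral; the `y`-part is a total derivative on
each fibre and integrates to zero. -/
theorem fiberIntegral_lineD (h k : Eucl d) (Φ : Test (Eucl d × Eucl d)) :
    fiberIntegral d (lineD (h, k) Φ) = lineD h (fiberIntegral d Φ) := by
  ext x
  have hK := Φ.hasCompactSupport.isCompact.image continuous_snd
  have h0 : ∀ x, ∀ y ∉ Prod.snd '' tsupport Φ, Φ (x, y) = 0 := fun x y hy ↦
    image_eq_zero_of_notMem_tsupport fun h ↦ hy ⟨_, h, rfl⟩
  have h1 : ContDiff ℝ 1 Φ := Φ.contDiff.of_le (by exact_mod_cast le_top)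
  have hfd : Continuous fun y ↦
      (fderiv ℝ Φ (x, y)).comp (ContinuousLinearMap.inl ℝ (Eucl d) (Eucl d)) :=
    ((h1.continuous_fderiv one_ne_zero).comp (Continuous.prodMk_right x)).clm_comp
      continuous_const
  have hint := hfd.integrable_of_hasCompactSupport (μ := volume)
    (HasCompactSupport.intro hK (fderiv_comp_inl_eq_zero h1 h0 x))
  have hR : lineD h (fiberIntegral d Φ) x = ∫ y, fderiv ℝ Φ (x, y) (h, 0) := by
    change fderiv ℝ (fun x ↦ ∫ y, Φ (x, y)) x h = _
    rw [(hasFDerivAt_fiberIntegral h1 hK h0 x).fderiv, ContinuousLinearMap.integral_apply hint]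
    rfl
  have hk : ∀ y, fderiv ℝ Φ (x, y) (0, k) = fderiv ℝ (fiber Φ x) y k := by
    intro y
    have := (Φ.differentiable (x, y)).hasFDerivAt.comp y (hasFDerivAt_prodMk_right x y)
    change _ = fderiv ℝ (⇑Φ ∘ fun y ↦ (x, y)) y k
    rw [this.fderiv]
    rfl
  have hL : ∀ y, lineD (h, k) Φ (x, y) =
      fderiv ℝ Φ (x, y) (h, 0) + fderiv ℝ (fiber Φ x) y k := by
    intro y
    rw [← hk, ← map_add]
    simp [lineD_apply]
  rw [hR, fiberIntegral_apply]
  simp_rw [hL]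
  have hi1 : Integrable fun y ↦ fderiv ℝ Φ (x, y) (h, 0) := hint.apply_continuousLinearMap h
  have hi2 : Integrable fun y ↦ fderiv ℝ (fiber Φ x) y k :=
    (lineD k (fiber Φ x)).continuous.integrable_of_hasCompactSupport
      (lineD k (fiber Φ x)).hasCompactSupport
  rw [integral_add hi1 hi2, Test.integral_fderiv_eq_zero, add_zero]

/-- The map `Φ ↦ (u ↦ ∫ Φ(u - c y, y) dy)`. -/
noncomputable def shearIntegral (c : Matrix (Fin d) (Fin d) ℝ) :
    Test (Eucl d × Eucl d) →ₗ[ℝ] Test (Eucl d) :=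
  (fiberIntegral d ∘L compEquiv (shear c) : _ →L[ℝ] _)

/-- The chain rule for `f(x + c y)` in transposed form: the shear sends `(h + c k, k)` to `(h, k)`,
and the fibre integral forgets the second component. -/
theorem shearIntegral_comp_lineD (c : Matrix (Fin d) (Fin d) ℝ) (h k : Eucl d) :
    shearIntegral c ∘ₗ lineD (h, k) =
      lineD (h + Matrix.toEuclideanCLM (𝕜 := ℝ) c k) ∘ₗ shearIntegral c := by
  refine LinearMap.ext fun Φ ↦ ?_
  have hs : shear c (h + Matrix.toEuclideanCLM (𝕜 := ℝ) c k, k) = (h, k) := by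
    rw [shear_apply, add_sub_cancel_right]
  have := compIso_lineD (shear c) (h + Matrix.toEuclideanCLM (𝕜 := ℝ) c k, k) Φ
  rw [hs] at this
  change fiberIntegral d (compIso (shear c) (lineD (h, k) Φ)) = _
  rw [this, fiberIntegral_lineD]
  rfl

/-- This makes `f(x + c y) = 0` imply `f = 0`. A preimage of `φ` is `φ(x + c y) ρ(y)` with `∫ ρ =
1`. -/
theorem shearIntegral_surjective (c : Matrix (Fin d) (Fin d) ℝ) :
    Function.Surjective (shearIntegral c) := by
  intro φ
  obtain ⟨ρ, hρ⟩ := exists_test_integral_eq_one (Eucl d) volume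
  refine ⟨compIso (shear c).symm (tens ρ φ), ?_⟩
  ext x
  change ∫ y, tens ρ φ ((shear c).symm (shear c (x, y))) = φ x
  simp only [ContinuousLinearEquiv.symm_apply_apply, tens_apply]
  rw [integral_const_mul, hρ, mul_one]

theorem toEuclideanCLM_surjective {c : Matrix (Fin d) (Fin d) ℝ} (hc : IsUnit c) :
    Function.Surjective (Matrix.toEuclideanCLM (𝕜 := ℝ) c) := by
  obtain ⟨u, rfl⟩ := hc
  intro v
  refine ⟨Matrix.toEuclideanCLM (𝕜 := ℝ) (↑u⁻¹ : Matrix (Fin d) (Fin d) ℝ) v, ?_⟩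
  rw [← mul_apply_eq_comp, ← map_mul, Units.mul_inv, map_one]
  rfl

/-- Directions in the first factor. -/
def fstDirections (d : ℕ) : Set (Eucl d × Eucl d) := {v | v.2 = 0}

/-- Directions in the second factor. -/
def sndDirections (d : ℕ) : Set (Eucl d × Eucl d) := {v | v.1 = 0}

/-- A derivative in `y` moves onto the weight `w(y)` with a minus sign, because the total derivative
integrates to zero. Each one thus lowers the degree of the weight. -/
theorem killsIn_weightedIntegral {n : ℕ} {w : Eucl d → ℝ} (hw : ContDiff ℝ ∞ w)
    (h : DegLT n w) (b : Test (Eucl d) →ₗ[ℝ] ℂ) :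
    KillsIn (sndDirections d) n
      (b ∘ₗ (fiberIntegral d ∘L mulSmooth (fun z : Eucl d × Eucl d ↦ w z.2)
        (hw.comp contDiff_snd) : _ →L[ℝ] _)) := by
  induction n generalizing w with
  | zero =>
    obtain rfl : w = 0 := h
    refine LinearMap.ext fun Φ ↦ ?_
    change b _ = 0
    rw [← map_zero b]
    congr 1
    ext x
    change ∫ y, Φ (x, y) * 0 = 0
    simp
  | succ n ih =>
    rintro ⟨v, k⟩ (rfl : v = 0)
    have hd : (fun z : Eucl d × Eucl d ↦ fderiv ℝ (fun z : Eucl d × Eucl d ↦ w z.2) z (0, k)) =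
        fun z ↦ fderiv ℝ w z.2 k := by
      ext z
      have := (hw.differentiable (by simp) z.2).hasFDerivAt.comp z hasFDerivAt_snd
      change fderiv ℝ (w ∘ Prod.snd) z (0, k) = _
      rw [this.fderiv]
      rfl
    convert (ih (contDiff_fderiv_apply hw k) (h k)).neg using 1
    refine LinearMap.ext fun Φ ↦ ?_
    change b (fiberIntegral d (mulSmooth _ _ (lineD (0, k) Φ))) =
      -b (fiberIntegral d (mulSmooth _ _ Φ))
    rw [lineD_mulSmooth (fun z : Eucl d × Eucl d ↦ w z.2) _ _
      (contDiff_fderiv_apply (hw.comp contDiff_snd) _), map_sub,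
      fiberIntegral_lineD, map_sub]
    have hz : lineD (0 : Eucl d) = 0 := by ext φ x; simp [lineD_apply]
    rw [hz]
    simp only [hd, LinearMap.zero_apply, map_zero, zero_sub]

theorem killsIn_tensorMonomialRight {s : ℕ} {β : Fin d → ℕ} (hβ : ∑ j, β j ≤ s)
    (b : Distr (Eucl d)) :
    KillsIn (sndDirections d) (s + 1) (tensorMonomialRight b β : _ →L[ℝ] ℂ).toLinearMap :=
  killsIn_weightedIntegral (contDiff_monomial β)
    ((degLT_monomial β).mono (Nat.succ_le_succ hβ)) (b : _ →L[ℝ] ℂ).toLinearMap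

theorem killsIn_tensorMonomialLeft {r : ℕ} {α : Fin d → ℕ} (hα : ∑ j, α j ≤ r)
    (a : Distr (Eucl d)) :
    KillsIn (fstDirections d) (r + 1) (tensorMonomialLeft α a : _ →L[ℝ] ℂ).toLinearMap := by
  refine (killsIn_tensorMonomialRight hα a).comp_of_intertwine
    (compIso (ContinuousLinearEquiv.prodComm ℝ (Eucl d) (Eucl d))) ?_
  rintro ⟨h, k⟩ (rfl : k = 0)
  exact ⟨(0, h), rfl, LinearMap.ext fun Φ ↦
    compIso_lineD (ContinuousLinearEquiv.prodComm ℝ (Eucl d) (Eucl d)) (0, h) Φ⟩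

theorem KillsIn.of_surjective {n : ℕ} {F : Test (Eucl d) →ₗ[ℝ] ℂ} {A : Eucl d → Eucl d}
    (hA : Function.Surjective A) (h : ∀ k, KillsIn Set.univ n (F ∘ₗ lineD (A k))) :
    KillsIn Set.univ (n + 1) F := by
  intro v _
  obtain ⟨k, rfl⟩ := hA v
  exact h k

theorem sum_comp_linearMap {M N P ι : Type*} [AddCommGroup M] [Module ℝ M] [AddCommGroup N]
    [Module ℝ N] [AddCommGroup P] [Module ℝ P] (S : Finset ι) (f : ι → N →ₗ[ℝ] P)
    (g : M →ₗ[ℝ] N) : (∑ i ∈ S, f i) ∘ₗ g = ∑ i ∈ S, f i ∘ₗ g := by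
  ext x
  simp

/-- If `f(x + c y) + ∑ⱼ fⱼ(x + cⱼ y) = 0` then all derivatives of `f` of some order vanish. -/
theorem killsIn_of_sum_eq_zero {ι : Type*} (S : Finset ι) (c₀ : Matrix (Fin d) (Fin d) ℝ)
    (c : ι → Matrix (Fin d) (Fin d) ℝ) (hc : ∀ j ∈ S, IsUnit (c₀ - c j))
    (f₀ : Test (Eucl d) →ₗ[ℝ] ℂ) (f : ι → Test (Eucl d) →ₗ[ℝ] ℂ)
    (h : f₀ ∘ₗ shearIntegral c₀ + ∑ j ∈ S, f j ∘ₗ shearIntegral (c j) = 0) :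
    KillsIn Set.univ S.card f₀ := by
  classical
  induction S using Finset.induction_on generalizing f₀ f with
  | empty =>
    refine LinearMap.ext fun φ ↦ ?_
    obtain ⟨Φ, rfl⟩ := shearIntegral_surjective c₀ φ
    simpa using LinearMap.congr_fun h Φ
  | insert j S hj ih =>
    rw [Finset.card_insert_of_notMem hj]
    refine KillsIn.of_surjective (toEuclideanCLM_surjective (hc j (Finset.mem_insert_self j S)))
      fun k ↦ ?_
    -- Along `(-c_j k, k)` the quantity `x + c_j y` is constant, so the `j`-th term disappears.
    have hk := congrArg
      (fun F ↦ F ∘ₗ lineD (-Matrix.toEuclideanCLM (𝕜 := ℝ) (c j) k, k)) h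
    simp only [LinearMap.add_comp, LinearMap.zero_comp, sum_comp_linearMap,
      Finset.sum_insert hj, LinearMap.comp_assoc, shearIntegral_comp_lineD] at hk
    have hz : lineD (-Matrix.toEuclideanCLM (𝕜 := ℝ) (c j) k +
        Matrix.toEuclideanCLM (𝕜 := ℝ) (c j) k) = 0 := by
      ext φ x
      simp [lineD_apply]
    rw [hz, LinearMap.zero_comp, LinearMap.comp_zero, zero_add] at hk
    refine ih (fun i hi ↦ hc i (Finset.mem_insert_of_mem hi)) _
      (fun i ↦ f i ∘ₗ lineD (-Matrix.toEuclideanCLM (𝕜 := ℝ) (c j) k +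
        Matrix.toEuclideanCLM (𝕜 := ℝ) (c i) k)) ?_
    rw [map_sub, _root_.sub_apply, sub_eq_neg_add]
    simpa only [LinearMap.comp_assoc] using hk

/-- Derivatives along `(0, k)` exhaust `B`, then derivatives along `(v, 0)` exhaust `A`, which
reduces to the homogeneous equation. Invertibility of `c₀` is needed only for `B`, where `f₀` is
differentiated along `c₀ k`. -/
theorem killsIn_of_sum_eq_add {ι : Type*} (S : Finset ι) (c₀ : Matrix (Fin d) (Fin d) ℝ)
    (c : ι → Matrix (Fin d) (Fin d) ℝ) (hc₀ : IsUnit c₀) (hc : ∀ j ∈ S, IsUnit (c₀ - c j))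
    (p q : ℕ) (A B : Test (Eucl d × Eucl d) →ₗ[ℝ] ℂ) (hA : KillsIn (fstDirections d) p A)
    (hB : KillsIn (sndDirections d) q B)
    (f₀ : Test (Eucl d) →ₗ[ℝ] ℂ) (f : ι → Test (Eucl d) →ₗ[ℝ] ℂ)
    (h : f₀ ∘ₗ shearIntegral c₀ + ∑ j ∈ S, f j ∘ₗ shearIntegral (c j) = A + B) :
    KillsIn Set.univ (S.card + p + q) f₀ := by
  have step : ∀ h₀ k A B, ∀ f₀ : Test (Eucl d) →ₗ[ℝ] ℂ, ∀ f : ι → Test (Eucl d) →ₗ[ℝ] ℂ,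
      f₀ ∘ₗ shearIntegral c₀ + ∑ j ∈ S, f j ∘ₗ shearIntegral (c j) = A + B →
      (f₀ ∘ₗ lineD (h₀ + Matrix.toEuclideanCLM (𝕜 := ℝ) c₀ k)) ∘ₗ shearIntegral c₀ +
        ∑ j ∈ S, (f j ∘ₗ lineD (h₀ + Matrix.toEuclideanCLM (𝕜 := ℝ) (c j) k)) ∘ₗ
          shearIntegral (c j) = A ∘ₗ lineD (h₀, k) + B ∘ₗ lineD (h₀, k) := by
    intro h₀ k A B f₀ f h
    have hk := congrArg (fun F ↦ F ∘ₗ lineD (h₀, k)) h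
    simpa only [LinearMap.add_comp, sum_comp_linearMap, LinearMap.comp_assoc,
      shearIntegral_comp_lineD] using hk
  induction q generalizing A B f₀ f with
  | succ q ih =>
    refine KillsIn.of_surjective (n := S.card + p + q) (toEuclideanCLM_surjective hc₀)
      fun k ↦ ?_
    have := step 0 k A B f₀ f h
    rw [zero_add] at this
    exact ih _ _ (hA.comp_lineD _) (hB _ rfl) _ _ this
  | zero =>
    rw [add_zero]
    obtain rfl : B = 0 := hB
    rw [add_zero] at h
    induction p generalizing A f₀ f with
    | zero =>
      obtain rfl : A = 0 := hA
      exact killsIn_of_sum_eq_zero S c₀ c hc f₀ f h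
    | succ p ih =>
      intro v _
      have := step v 0 A 0 f₀ f (by rw [h, add_zero])
      rw [map_zero, add_zero, LinearMap.zero_comp, add_zero] at this
      exact ih _ (hA (v, 0) rfl) _ _ this

end Elimination

/-! ### Integrals and primitives along lines -/

section LineIntegration

variable {V : Type} [NormedAddCommGroup V] [NormedSpace ℝ V]

/-- Used with `f = 1` for the smoothness of line integrals, and with the Heaviside function for that
of primitives. -/
theorem contDiff_fiberConvolution {f : ℝ → ℝ} (hf : LocallyIntegrable f volume)
    (Φ : Test (V × ℝ)) : ContDiff ℝ ∞ fun z : V × ℝ ↦ ∫ s, f s * Φ (z.1, z.2 - s) := by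
  have h := contDiffOn_convolution_right_with_param (n := ⊤) (μ := volume)
    (ContinuousLinearMap.mul ℝ ℝ) (g := fun x t ↦ Φ (x, t)) (s := Set.univ)
    isOpen_univ (Φ.hasCompactSupport.isCompact.image continuous_snd)
    (fun x t _ ht ↦ image_eq_zero_of_notMem_tsupport fun h ↦ ht ⟨_, h, rfl⟩) hf
    (by rw [Set.univ_prod_univ]; exact Φ.contDiff.contDiffOn)
  rw [Set.univ_prod_univ, contDiffOn_univ] at h
  exact h

/-- Integration over lines on test functions. -/
noncomputable def lineIntegral (Φ : Test (V × ℝ)) : Test V :=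
  ⟨fun x ↦ ∫ t, Φ (x, t),
    by
      have h := (contDiff_fiberConvolution (f := fun _ ↦ 1) (locallyIntegrable_const 1) Φ).comp
        (contDiff_prodMk_left (0 : ℝ))
      convert h using 2 with x
      simpa using (integral_sub_left_eq_self (fun t ↦ Φ (x, t)) volume 0).symm,
    HasCompactSupport.intro (Φ.hasCompactSupport.isCompact.image continuous_fst) fun x hx ↦ by
      have : ∀ t, Φ (x, t) = 0 := fun t ↦
        image_eq_zero_of_notMem_tsupport fun h ↦ hx ⟨_, h, rfl⟩
      simp [this],
    fun _ _ ↦ trivial⟩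

theorem lineIntegral_apply (Φ : Test (V × ℝ)) (x : V) : lineIntegral Φ x = ∫ t, Φ (x, t) := rfl

theorem integrable_fiber (Φ : Test (V × ℝ)) (x : V) : Integrable fun t ↦ Φ (x, t) :=
  (fiber Φ x).continuous.integrable_of_hasCompactSupport (fiber Φ x).hasCompactSupport

/-- A test function whose line integrals vanish is a derivative along these lines. -/
theorem exists_lineD_eq (Φ : Test (V × ℝ)) (h : lineIntegral Φ = 0) :
    ∃ Ψ : Test (V × ℝ), lineD (0, 1) Ψ = Φ := by
  -- The primitive from `-∞` is a convolution with the Heaviside function, hence jointly smooth.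
  have hconv : ∀ z : V × ℝ, ∫ s, (Set.Ici (0 : ℝ)).indicator 1 s * Φ (z.1, z.2 - s) =
      ∫ t in Set.Iic z.2, Φ (z.1, t) := by
    intro z
    rw [← integral_indicator measurableSet_Iic, ← integral_sub_left_eq_self
      ((Set.Iic z.2).indicator fun t ↦ Φ (z.1, t)) volume z.2]
    congr 1 with s
    by_cases hs : 0 ≤ s <;> simp [Set.indicator, hs]
  have hsm : ContDiff ℝ ∞ fun z : V × ℝ ↦ ∫ t in Set.Iic z.2, Φ (z.1, t) := by
    simp_rw [← hconv]
    exact contDiff_fiberConvolution ((locallyIntegrable_const 1).indicator measurableSet_Ici) Φ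
  have hfst := Φ.hasCompactSupport.isCompact.image continuous_fst
  have hsnd := Φ.hasCompactSupport.isCompact.image continuous_snd
  obtain ⟨R, hR⟩ := hsnd.isBounded.subset_closedBall 0
  have hzero : ∀ x t, R < |t| → Φ (x, t) = 0 := fun x t ht ↦
    image_eq_zero_of_notMem_tsupport fun hm ↦ by
      have := hR ⟨_, hm, rfl⟩
      rw [mem_closedBall_zero_iff, Real.norm_eq_abs] at this
      exact absurd ht (not_lt.2 this)
  let Ψ : Test (V × ℝ) := ⟨fun z ↦ ∫ t in Set.Iic z.2, Φ (z.1, t), hsm,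
    HasCompactSupport.intro (hfst.prod (isCompact_closedBall (0 : ℝ) R)) fun z hz ↦ by
      by_cases hx : z.1 ∈ Prod.fst '' tsupport Φ
      · have ht : R < |z.2| := by
          by_contra hcon
          exact hz ⟨hx, by simpa using hcon⟩
        -- Above `R` the primitive equals the full line integral, zero by `h`; below `-R` its
        -- integrand vanishes.
        rcases lt_abs.1 ht with ht | ht
        · rw [setIntegral_eq_integral_of_forall_compl_eq_zero]
          · exact DFunLike.congr_fun h z.1
          · intro t htz
            exact hzero _ _ ((ht.trans (not_le.1 htz)).trans_le (le_abs_self t))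
        · refine setIntegral_eq_zero_of_forall_eq_zero fun t (htz : t ≤ z.2) ↦ ?_
          exact hzero _ _ (lt_of_lt_of_le (by linarith) (neg_le_abs t))
      · have : ∀ t, Φ (z.1, t) = 0 := fun t ↦
          image_eq_zero_of_notMem_tsupport fun h ↦ hx ⟨_, h, rfl⟩
        simp [this],
    fun _ _ ↦ trivial⟩
  refine ⟨Ψ, ?_⟩
  ext ⟨x, t⟩
  have h1 : HasDerivAt (fun t ↦ Ψ (x, t)) (fderiv ℝ Ψ (x, t) (0, 1)) t :=
    (Ψ.differentiable (x, t)).hasFDerivAt.comp_hasDerivAt t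
      ((hasDerivAt_const t x).prodMk (hasDerivAt_id t))
  have hc : Continuous fun t ↦ Φ (x, t) := (fiber Φ x).continuous
  have h2 : HasDerivAt (fun t ↦ Ψ (x, t)) (Φ (x, t)) t := by
    have : (fun t ↦ Ψ (x, t)) =
        fun t ↦ (∫ s in Set.Iic 0, Φ (x, s)) + ∫ s in (0 : ℝ)..t, Φ (x, s) := by
      ext t
      rw [← intervalIntegral.integral_Iic_sub_Iic (integrable_fiber Φ x).integrableOn
        (integrable_fiber Φ x).integrableOn]
      exact (add_sub_cancel _ _).symm
    rw [this]
    exact (intervalIntegral.integral_hasDerivAt_right (hc.intervalIntegrable _ _)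
      (hc.stronglyMeasurableAtFilter _ _) hc.continuousAt).const_add _
  exact h1.unique h2

theorem Test.integrable_mul [MeasurableSpace V] [BorelSpace V] {μ : Measure V}
    [IsFiniteMeasureOnCompacts μ] (φ : Test V) {g : V → ℂ} (hg : Continuous g) :
    Integrable (fun x ↦ (φ x : ℂ) * g x) μ := by
  refine (Continuous.mul (Complex.continuous_ofReal.comp φ.continuous) hg
    ).integrable_of_hasCompactSupport (HasCompactSupport.mul_right ?_)
  exact φ.hasCompactSupport.comp_left (g := fun r : ℝ ↦ (r : ℂ)) Complex.ofReal_zero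

end LineIntegration

/-! ### Polynomial functions with one variable singled out -/

section PolynomialFunctions

variable {d : ℕ}

open MvPolynomial

/-- The polynomial function on `ℝ^d` attached to a complex polynomial. -/
noncomputable def polyFun (P : MvPolynomial (Fin d) ℂ) (x : Eucl d) : ℂ :=
  eval (fun j ↦ (x j : ℂ)) P

/-- The polynomial function on `ℝ^d × ℝ` attached to a complex polynomial, the last factor being
the variable of index `0`. -/
noncomputable def polyFunProd (P : MvPolynomial (Fin (d + 1)) ℂ) (z : Eucl d × ℝ) : ℂ :=
  eval (Fin.cons (z.2 : ℂ) fun j ↦ (z.1 j : ℂ)) P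

theorem continuous_polyFun (P : MvPolynomial (Fin d) ℂ) : Continuous (polyFun P) := by
  refine P.continuous_eval.comp (continuous_pi fun j ↦ ?_)
  fun_prop

theorem continuous_polyFunProd (P : MvPolynomial (Fin (d + 1)) ℂ) :
    Continuous (polyFunProd P) := by
  refine P.continuous_eval.comp (continuous_pi fun j ↦ ?_)
  refine Fin.cases ?_ (fun j ↦ ?_) j
  · simp only [Fin.cons_zero]; fun_prop
  · simp only [Fin.cons_succ]; fun_prop

theorem polyFunProd_symm (Q : Polynomial (MvPolynomial (Fin d) ℂ)) (z : Eucl d × ℝ) :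
    polyFunProd ((finSuccEquiv ℂ d).symm Q) z =
      (Q.map (eval fun j ↦ (z.1 j : ℂ))).eval (z.2 : ℂ) := by
  rw [polyFunProd, eval_eq_eval_mv_eval', AlgEquiv.apply_symm_apply]

theorem polyFunProd_symm_add (Q R : Polynomial (MvPolynomial (Fin d) ℂ)) (z : Eucl d × ℝ) :
    polyFunProd ((finSuccEquiv ℂ d).symm (Q + R)) z =
      polyFunProd ((finSuccEquiv ℂ d).symm Q) z + polyFunProd ((finSuccEquiv ℂ d).symm R) z := by
  simp only [polyFunProd_symm, Polynomial.map_add, Polynomial.eval_add]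

theorem polyFunProd_symm_monomial (n : ℕ) (a : MvPolynomial (Fin d) ℂ) (z : Eucl d × ℝ) :
    polyFunProd ((finSuccEquiv ℂ d).symm (Polynomial.monomial n a)) z =
      polyFun a z.1 * (z.2 : ℂ) ^ n := by
  rw [polyFunProd_symm, Polynomial.map_monomial, Polynomial.eval_monomial]
  rfl

/-- Viewing `P` as a polynomial in `t` over `ℂ[x]` reduces additive claims to the terms `a(x) t^n`.
-/
theorem polyFunProd_induction {motive : MvPolynomial (Fin (d + 1)) ℂ → Prop}
    (P : MvPolynomial (Fin (d + 1)) ℂ)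
    (add : ∀ Q R, motive ((finSuccEquiv ℂ d).symm Q) → motive ((finSuccEquiv ℂ d).symm R) →
      motive ((finSuccEquiv ℂ d).symm (Q + R)))
    (monomial : ∀ n a, motive ((finSuccEquiv ℂ d).symm (Polynomial.monomial n a))) :
    motive P := by
  rw [← (finSuccEquiv ℂ d).symm_apply_apply P]
  induction finSuccEquiv ℂ d P using Polynomial.induction_on' with
  | add Q R hQ hR => exact add Q R hQ hR
  | monomial n a => exact monomial n a

theorem exists_polyFunProd_antideriv (P : MvPolynomial (Fin (d + 1)) ℂ) :
    ∃ G : MvPolynomial (Fin (d + 1)) ℂ, ∀ (x : Eucl d) (t : ℝ),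
      HasDerivAt (fun t ↦ polyFunProd G (x, t)) (polyFunProd P (x, t)) t := by
  induction P using polyFunProd_induction with
  | add Q R hQ hR =>
    obtain ⟨G, hG⟩ := hQ
    obtain ⟨H, hH⟩ := hR
    refine ⟨G + H, fun x t ↦ ?_⟩
    rw [polyFunProd_symm_add]
    have := (hG x t).add (hH x t)
    simpa only [polyFunProd, map_add] using! this
  | monomial n a =>
    refine ⟨(finSuccEquiv ℂ d).symm (Polynomial.monomial (n + 1) (C ((n + 1 : ℂ)⁻¹) * a)),
      fun x t ↦ ?_⟩
    simp only [polyFunProd_symm_monomial]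
    have h := ((Complex.ofRealCLM.hasDerivAt (x := t)).pow (n + 1)).const_mul
      (polyFun (C ((n + 1 : ℂ)⁻¹) * a) x)
    refine HasDerivAt.congr_deriv h ?_
    have hn : (n + 1 : ℂ) ≠ 0 := by exact_mod_cast n.succ_ne_zero
    simp [polyFun]
    field_simp

theorem exists_polyFun_eq_integral (η : Test ℝ) (G : MvPolynomial (Fin (d + 1)) ℂ) :
    ∃ c : MvPolynomial (Fin d) ℂ, ∀ x : Eucl d,
      ∫ t, (η t : ℂ) * polyFunProd G (x, t) = polyFun c x := by
  have hint : ∀ (P : MvPolynomial (Fin (d + 1)) ℂ) (x : Eucl d),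
      Integrable fun t ↦ (η t : ℂ) * polyFunProd P (x, t) := fun P x ↦
    η.integrable_mul ((continuous_polyFunProd P).comp (Continuous.prodMk_right x))
  induction G using polyFunProd_induction with
  | add Q R hQ hR =>
    obtain ⟨a, ha⟩ := hQ
    obtain ⟨b, hb⟩ := hR
    refine ⟨a + b, fun x ↦ ?_⟩
    simp_rw [polyFunProd_symm_add, mul_add]
    rw [integral_add (hint _ x) (hint _ x), ha, hb]
    simp [polyFun]
  | monomial n a =>
    refine ⟨a * C (∫ t, (η t : ℂ) * (t : ℂ) ^ n), fun x ↦ ?_⟩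
    simp_rw [polyFunProd_symm_monomial, mul_left_comm _ (polyFun a x)]
    rw [integral_const_mul]
    simp [polyFun]

theorem exists_polyFunProd_eq_fst (c : MvPolynomial (Fin d) ℂ) :
    ∃ P : MvPolynomial (Fin (d + 1)) ℂ, ∀ z, polyFunProd P z = polyFun c z.1 :=
  ⟨(finSuccEquiv ℂ d).symm (Polynomial.monomial 0 c), fun z ↦ by
    rw [polyFunProd_symm_monomial, pow_zero, mul_one]⟩

end PolynomialFunctions

/-! ### Functionals with vanishing derivatives are polynomials -/

section Step

variable {d : ℕ}

theorem integral_lineIntegral_mul (Φ : Test (Eucl d × ℝ)) {g : Eucl d → ℂ} (hg : Continuous g) :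
    ∫ x, (lineIntegral Φ x : ℂ) * g x = ∫ z : Eucl d × ℝ, (Φ z : ℂ) * g z.1 := by
  have hi : Integrable (fun z : Eucl d × ℝ ↦ (Φ z : ℂ) * g z.1) (volume.prod volume) :=
    Φ.integrable_mul (hg.comp continuous_fst)
  rw [Measure.volume_eq_prod, integral_prod _ hi]
  congr 1 with x
  change _ = ∫ t, (Φ (x, t) : ℂ) * g x
  rw [integral_mul_const, lineIntegral_apply, integral_complex_ofReal]

theorem integral_lineD_mul (Ψ : Test (Eucl d × ℝ)) {g G : Eucl d × ℝ → ℂ} (hg : Continuous g)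
    (hG : Continuous G) (h : ∀ x t, HasDerivAt (fun t ↦ G (x, t)) (g (x, t)) t) :
    ∫ z, (Ψ z : ℂ) * g z = -∫ z, (lineD (0, 1) Ψ z : ℂ) * G z := by
  have : (volume : Measure (Eucl d × ℝ)).IsAddHaarMeasure :=
    inferInstanceAs (volume.prod volume).IsAddHaarMeasure
  have := integral_bilinear_hasLineDerivAt_right_eq_neg_left_of_integrable
    (μ := (volume : Measure (Eucl d × ℝ))) (f := Ψ) (f' := lineD (0, 1) Ψ) (g := G) (g' := g)
    (v := (0, 1)) (B := ContinuousLinearMap.lsmul ℝ ℝ)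
    (by simpa using (lineD (0, 1) Ψ).integrable_mul hG) (by simpa using Ψ.integrable_mul hg)
    (by simpa using Ψ.integrable_mul hG)
    (fun z _ ↦ (Ψ.differentiable z).hasFDerivAt.hasLineDerivAt _)
    (fun z _ ↦ by
      have h1 : HasDerivAt (fun t ↦ G (z.1, t)) (g z) (z.2 + 0) := by
        rw [add_zero]; exact h z.1 z.2
      have h2 := h1.comp_const_add z.2 0
      have h3 : ∀ t : ℝ, z + t • ((0, 1) : Eucl d × ℝ) = (z.1, z.2 + t) := fun t ↦ by
        ext <;> simp
      simpa only [HasLineDerivAt, h3] using h2)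
  simpa using this

/-- Functionals on `ℝ^d` annihilating all derivatives of some order are polynomial. -/
def AnnihilatedArePolynomial (d : ℕ) : Prop :=
  ∀ (n : ℕ) (T : Test (Eucl d) →ₗ[ℝ] ℂ), KillsIn Set.univ n T →
    ∃ P : MvPolynomial (Fin d) ℂ, ∀ φ, T φ = ∫ x, (φ x : ℂ) * polyFun P x

/-- With `∫ η = 1`, the difference between `Φ` and `η(t) ∫ Φ(x, ·)` has zero line integrals, so it
equals `∂_t Ψ`. On the tensor part `T` is a functional in dimension `d`, given by `p`; on `∂_t Ψ` it
is killed at order `n`, so it is given by some `g`. -/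
theorem exists_polyFunProd_of_killsIn (hd : AnnihilatedArePolynomial d) (n : ℕ)
    (T : Test (Eucl d × ℝ) →ₗ[ℝ] ℂ) (hT : KillsIn Set.univ n T) :
    ∃ P : MvPolynomial (Fin (d + 1)) ℂ, ∀ Φ, T Φ = ∫ z, (Φ z : ℂ) * polyFunProd P z := by
  induction n generalizing T with
  | zero =>
    obtain rfl : T = 0 := hT
    exact ⟨0, fun Φ ↦ by simp [polyFunProd]⟩
  | succ n ih =>
    obtain ⟨η, hη⟩ := exists_test_integral_eq_one ℝ volume
    obtain ⟨p, hp⟩ := hd (n + 1) (T ∘ₗ tens η) (hT.comp_of_intertwine (tens η) fun v _ ↦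
      ⟨(v, 0), trivial, LinearMap.ext fun φ ↦ (lineD_tens η φ v).symm⟩)
    obtain ⟨g, hg⟩ := ih (T ∘ₗ lineD (0, 1)) (hT _ trivial)
    obtain ⟨G, hG⟩ := exists_polyFunProd_antideriv g
    obtain ⟨c, hc⟩ := exists_polyFun_eq_integral η G
    obtain ⟨P, hP⟩ := exists_polyFunProd_eq_fst (p + c)
    -- The density is `p + c - G`: integrating `Ψ g` by parts gives `-∫ (∂_t Ψ) G`, whose `Φ` part
    -- yields `-G` and whose tensor part yields the `η`-average `c` of `G`.
    refine ⟨P - G, fun Φ ↦ ?_⟩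
    obtain ⟨Ψ, hΨ⟩ := exists_lineD_eq (Φ - tens η (lineIntegral Φ)) (by
      ext x
      change ∫ t, (Φ (x, t) - lineIntegral Φ x * η t) = 0
      rw [integral_sub (integrable_fiber Φ x)
        ((η.continuous.integrable_of_hasCompactSupport η.hasCompactSupport).const_mul _),
        integral_const_mul, hη, mul_one, lineIntegral_apply, sub_self])
    have hTΨ : T Φ = (T ∘ₗ tens η) (lineIntegral Φ) + (T ∘ₗ lineD (0, 1)) Ψ := by
      simp [hΨ]
    have htens : ∫ z, (tens η (lineIntegral Φ) z : ℂ) * polyFunProd G z =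
        ∫ z : Eucl d × ℝ, (Φ z : ℂ) * polyFun c z.1 := by
      rw [← integral_lineIntegral_mul Φ (continuous_polyFun c), Measure.volume_eq_prod,
        integral_prod _ (Test.integrable_mul _ (continuous_polyFunProd G))]
      congr 1 with x
      simp_rw [← hc x, tens_apply, Complex.ofReal_mul, mul_assoc]
      rw [integral_const_mul]
    rw [hTΨ, hp, hg, integral_lineD_mul Ψ (continuous_polyFunProd g) (continuous_polyFunProd G) hG,
      hΨ, integral_lineIntegral_mul Φ (continuous_polyFun p)]
    have hsub : ∀ z, ((Φ - tens η (lineIntegral Φ)) z : ℂ) * polyFunProd G z =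
        (Φ z : ℂ) * polyFunProd G z - (tens η (lineIntegral Φ) z : ℂ) * polyFunProd G z := by
      intro z
      rw [← sub_mul, ← Complex.ofReal_sub]
      rfl
    have hPG : ∀ z, (Φ z : ℂ) * polyFunProd (P - G) z =
        (Φ z : ℂ) * polyFun p z.1 + (Φ z : ℂ) * polyFun c z.1 - (Φ z : ℂ) * polyFunProd G z := by
      intro z
      rw [show polyFunProd (P - G) z = polyFunProd P z - polyFunProd G z from map_sub _ _ _, hP,
        show polyFun (p + c) z.1 = polyFun p z.1 + polyFun c z.1 from map_add _ _ _]
      ring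
    have hi1 : Integrable fun z : Eucl d × ℝ ↦ (Φ z : ℂ) * polyFun p z.1 :=
      Φ.integrable_mul ((continuous_polyFun p).comp continuous_fst)
    have hi2 : Integrable fun z : Eucl d × ℝ ↦ (Φ z : ℂ) * polyFun c z.1 :=
      Φ.integrable_mul ((continuous_polyFun c).comp continuous_fst)
    have hi3 := Φ.integrable_mul (μ := volume) (continuous_polyFunProd G)
    simp_rw [hsub, hPG]
    rw [integral_sub hi3 (Test.integrable_mul _ (continuous_polyFunProd G)), htens,
      integral_sub (f := fun z ↦ (Φ z : ℂ) * polyFun p z.1 + (Φ z : ℂ) * polyFun c z.1)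
        (hi1.add hi2) hi3, integral_add hi1 hi2]
    ring

/-- The isomorphism `(x, t) ↦ (t, x₁, …, x_d)`. -/
noncomputable def consEquiv (d : ℕ) : (Eucl d × ℝ) ≃L[ℝ] Eucl (d + 1) :=
  LinearEquiv.toContinuousLinearEquiv
    { toFun := fun z ↦ WithLp.toLp 2 (Fin.cons z.2 fun j ↦ z.1 j)
      invFun := fun y ↦ (WithLp.toLp 2 fun j ↦ y j.succ, y 0)
      map_add' := fun z w ↦ by
        ext j
        refine Fin.cases ?_ (fun j ↦ ?_) j <;> simp
      map_smul' := fun r z ↦ by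
        ext j
        refine Fin.cases ?_ (fun j ↦ ?_) j <;> simp
      left_inv := fun z ↦ by ext <;> simp
      right_inv := fun y ↦ by
        ext j
        refine Fin.cases ?_ (fun j ↦ ?_) j <;> simp }

theorem consEquiv_zero (z : Eucl d × ℝ) : consEquiv d z 0 = z.2 := rfl

theorem consEquiv_succ (z : Eucl d × ℝ) (j : Fin d) : consEquiv d z j.succ = z.1 j := rfl

theorem measurePreserving_consEquiv (d : ℕ) :
    MeasurePreserving (consEquiv d) volume volume := by
  have h1 : MeasurePreserving (Prod.map (WithLp.ofLp : Eucl d → Fin d → ℝ) (id : ℝ → ℝ))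
      (volume.prod volume) (volume.prod volume) :=
    (PiLp.volume_preserving_ofLp (Fin d)).prod (MeasurePreserving.id _)
  have h2 := (volume_preserving_piFinSuccAbove (fun _ : Fin (d + 1) ↦ ℝ) 0).symm
  have h3 := PiLp.volume_preserving_toLp (Fin (d + 1))
  have h := h3.comp (h2.comp (Measure.measurePreserving_swap.comp h1))
  have he : ⇑(consEquiv d) = WithLp.toLp 2 ∘
      (MeasurableEquiv.piFinSuccAbove (fun _ : Fin (d + 1) ↦ ℝ) 0).symm ∘ Prod.swap ∘
        Prod.map WithLp.ofLp id := by
    funext z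
    ext j
    refine Fin.cases ?_ (fun j ↦ ?_) j
    · simp [consEquiv_zero, MeasurableEquiv.piFinSuccAbove]
    · simp [consEquiv_succ, MeasurableEquiv.piFinSuccAbove]
  rw [he]
  exact h

theorem polyFun_consEquiv (P : MvPolynomial (Fin (d + 1)) ℂ) (z : Eucl d × ℝ) :
    polyFun P (consEquiv d z) = polyFunProd P z := by
  unfold polyFun polyFunProd
  congr 2
  ext j
  refine Fin.cases ?_ (fun j ↦ ?_) j
  · simp [consEquiv_zero]
  · simp [consEquiv_succ]

theorem AnnihilatedArePolynomial.succ (hd : AnnihilatedArePolynomial d) :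
    AnnihilatedArePolynomial (d + 1) := by
  intro n T hT
  obtain ⟨P, hP⟩ := exists_polyFunProd_of_killsIn hd n (T ∘ₗ compIso (consEquiv d).symm)
    (hT.comp_of_intertwine _ fun w _ ↦ ⟨consEquiv d w, trivial, LinearMap.ext fun Φ ↦ by
      simpa using compIso_lineD (consEquiv d).symm (consEquiv d w) Φ⟩)
  refine ⟨P, fun φ ↦ ?_⟩
  have h := hP (compIso (consEquiv d) φ)
  have hφ : compIso (consEquiv d).symm (compIso (consEquiv d) φ) = φ := by
    ext x
    simp [compIso_apply]
  rw [LinearMap.comp_apply, hφ] at h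
  rw [h, ← (measurePreserving_consEquiv d).integral_comp
    (consEquiv d).toHomeomorph.measurableEmbedding]
  simp_rw [polyFun_consEquiv]
  rfl

theorem annihilatedArePolynomial (d : ℕ) : AnnihilatedArePolynomial d := by
  induction d with
  | zero =>
    intro n T _
    obtain ⟨ρ, hρ⟩ := exists_test_integral_eq_one (Eucl 0) volume
    refine ⟨MvPolynomial.C (T ρ), fun φ ↦ ?_⟩
    -- `ℝ^0` is a point, so test functions form a line spanned by `ρ`, and `T` is the constant `T
    -- ρ`.
    have hφ : φ = (∫ x, φ x) • ρ := by
      ext x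
      have hc : ∀ ψ : Test (Eucl 0), ⇑ψ = fun _ ↦ ψ x := fun ψ ↦
        funext fun y ↦ congrArg ψ (Subsingleton.elim y x)
      change φ x = (∫ x, φ x) * ρ x
      rw [hc ρ, integral_const, smul_eq_mul] at hρ
      rw [hc φ, integral_const, smul_eq_mul, mul_right_comm, hρ, one_mul]
    simp only [polyFun, MvPolynomial.eval_C]
    rw [integral_mul_const, integral_complex_ofReal]
    conv_lhs => rw [hφ, map_smul]
    exact Complex.real_smul
  | succ d ih => exact ih.succ

end Step

end GhuryeOlkin

/-! ### Assembly of the theorem -/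

theorem mainTheorem8 (d m r s : ℕ) (c : Fin m → Matrix (Fin d) (Fin d) ℝ)
    (hc : ∀ i, IsUnit (c i)) (hcc : ∀ i j, i ≠ j → IsUnit (c i - c j))
    (f : Fin m → GhuryeOlkin.Distr (GhuryeOlkin.Eucl d))
    (a b : (Fin d → ℕ) → GhuryeOlkin.Distr (GhuryeOlkin.Eucl d))
    (heq : ∑ i, GhuryeOlkin.pullback (c i) (f i) =
      ∑ α ∈ GhuryeOlkin.multiIndices d r, GhuryeOlkin.tensorMonomialLeft α (a α) +
        ∑ β ∈ GhuryeOlkin.multiIndices d s, GhuryeOlkin.tensorMonomialRight (b β) β) :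
    ∀ i, GhuryeOlkin.IsPolynomial (f i) := by
  intro i
  -- Forgetting continuity is itself linear, so it can be pushed through the sums in `heq`.
  let toLin : GhuryeOlkin.Distr (GhuryeOlkin.Eucl d × GhuryeOlkin.Eucl d) →ₗ[ℝ]
      GhuryeOlkin.Test (GhuryeOlkin.Eucl d × GhuryeOlkin.Eucl d) →ₗ[ℝ] ℂ :=
    { toFun := fun T ↦ (T : _ →L[ℝ] ℂ).toLinearMap
      map_add' := fun _ _ ↦ rfl
      map_smul' := fun _ _ ↦ rfl }
  have h := congrArg toLin heq
  rw [map_add, map_sum, map_sum, map_sum, ← Finset.add_sum_erase _ _ (Finset.mem_univ i)] at h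
  -- Degree at most `r` needs `r + 1` derivatives to vanish, and likewise `s + 1` for `s`.
  have hkill := GhuryeOlkin.killsIn_of_sum_eq_add (Finset.univ.erase i) (c i) c (hc i)
    (fun j hj ↦ hcc i j (Finset.ne_of_mem_erase hj).symm) (r + 1) (s + 1) _ _
    (GhuryeOlkin.KillsIn.sum _ fun α hα ↦
      GhuryeOlkin.killsIn_tensorMonomialLeft (GhuryeOlkin.mem_multiIndices.1 hα) (a α))
    (GhuryeOlkin.KillsIn.sum _ fun β hβ ↦
      GhuryeOlkin.killsIn_tensorMonomialRight (GhuryeOlkin.mem_multiIndices.1 hβ) (b β))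
    (f i : _ →L[ℝ] ℂ).toLinearMap (fun j ↦ (f j : _ →L[ℝ] ℂ).toLinearMap) h
  exact GhuryeOlkin.annihilatedArePolynomial d _ _ hkill
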